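/- Let $\mathcal{T}$ be a triangulated category with suspension functor $[1]$. **Conventions.** A *class* is a class of objects of $\mathcal{T}$. A *subcategory* is a full additive subcategory closed under isomorphisms. For classes $\mathcal{A},\mathcal{B}$: - $\mathcal{A}*\mathcal{B}$ is the class of all $Z$ admitting a distinguished triangle $A\to Z\to B\to A[1]$ with $A\in\mathcal{A}$, $B\in\mathcal{B}$; - $\mathcal{A}^\perp=\{Z:\mathrm{Hom}_{\mathcal{T}}(A,Z)=0\ \ \forall A\in\mathcal{A}\}$, and $\mathcal{A}[n]=\{Z : Z[-n]\in\mathcal{A}\}$; - $\mathcal{A}$ is *cosuspended* (resp. *suspended*) if it is nonempty, $\mathcal{A}*\mathcal{A}\subseteq\mathcal{A}$, and $A[-1]\in\mathcal{A}$ (resp. $A[1]\in\mathcal{A}$) for all $A\in\mathcal{A}$; - $\mathcal{A}^\wedge=\bigcup_{n\ge 0}\varepsilon_n^\wedge(\mathcal{A})$, where $\varepsilon^\wedge_0(\mathcal{A})=\mathcal{A}$ and $\varepsilon^\wedge_{n}(\mathcal{A})$, $n\geq 1$, consists of all $Z$ admitting a distinguished triangle $W\to A\to Z\to W[1]$ with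 $W\in\varepsilon^\wedge_{n-1}(\mathcal{A})$ and $A\in\mathcal{A}$; - $\overline{\Delta}(\mathcal{A})$ is the smallest thick subcategory (triangulated subcategory closed under direct summands) containing $\mathcal{A}$; - $\mathrm{add}(\mathcal{A})$ is the smallest subcategory containing $\mathcal{A}$ and closed under finite direct sums and direct summands; - $\mathrm{id}_{\mathcal{A}}(M)$ is the least $n\in\mathbb{N}$ such that $\mathrm{Hom}_{\mathcal{T}}(A,M[i])=0$ for all $A\in\mathcal{A}$ and $i>n$ ($\infty$ if there is none), and $\mathrm{id}_{\mathcal{A}}(\mathcal{B})=\sup_{M\in\mathcal{B}}\mathrm{id}_{\mathcal{A}}(M)$; $\mathcal{B}$ is *$\mathcal{A}$-injective* if $\mathrm{id}_{\mathcal{A}}(\mathcal{B})=0$; - $\mathcal{B}$ is a *weak-cogenerator* in $\mathcal{A}$ if $\mathcal{B}\subseteq\mathcal{A}\subseteq\mathcal{A}[-1]*\mathcal{B}$; - $\mathcal{A}$ is *precovering* in $\mathcal{B}$ if each $Z\in\mathcal{B}$ admits a morphism $f:A\to Z$ with $A\in\mathcal{A}$ such that every morphism $A'\to Z$ with $A'\in\mathcal{A}$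 factors through $f$. A *co-$t$-structure* on a triangulated category $\mathcal{U}$ is a pair $(\mathcal{A},\mathcal{B})$ of subcategories of $\mathcal{U}$, both closed under direct summands in $\mathcal{U}$, with $\mathcal{A}[-1]\subseteq\mathcal{A}$, $\mathcal{B}[1]\subseteq\mathcal{B}$, $\mathrm{Hom}(\mathcal{A}[-1],\mathcal{B})=0$ and $\mathcal{U}=\mathcal{A}[-1]*\mathcal{B}$. A *relative Auslander–Buchweitz context* on $\mathcal{T}$ is a pair $(\mathcal{X},\mathcal{Y})$ of classes closed under direct summands such that $\mathcal{X}$ is cosuspended, $\mathcal{Y}$ is suspended, $\mathcal{Y}\subseteq\mathcal{X}^\wedge$, and $\mathcal{X}\cap\mathcal{Y}$ is an $\mathcal{X}$-injective weak-cogenerator in $\mathcal{X}$. Consider - $\mathbf{C}_1$: the pairs $(\mathcal{X},\omega)$ of classes closed under direct summands, with $\mathcal{X}$ cosuspended and $\omega$ an $\mathcal{X}$-injective weak-cogenerator in $\mathcal{X}$; - $\mathbf{C}_2$: the relative Auslander–Buchweitz contexts $(\mathcal{X},\mathcal{Y})$ on $\mathcal{T}$; - $\mathbf{C}_3$: the pairs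 $(\mathcal{X},\mathcal{Y})$ of classes that are a co-$t$-structure on $\overline{\Delta}(\mathcal{X})$; - $\mathbf{C}_4$: the cosuspended classes $\mathcal{X}=\mathrm{add}(\mathcal{X})$ that are precovering in $\mathcal{X}^\wedge$. **Theorem.** (a) $\mathbf{C}_2=\mathbf{C}_3$, and $(\mathcal{X},\omega)\mapsto(\mathcal{X},\omega^\wedge)$ is a bijection $\mathbf{C}_1\to\mathbf{C}_2$ with inverse $\mathbf{C}_2\to\mathbf{C}_1$, $(\mathcal{X},\mathcal{Y})\mapsto(\mathcal{X},\mathcal{X}\cap\mathcal{Y})$. (b) Let $R$ be a commutative artinian ring, and suppose that $\mathcal{T}$ is $R$-linear, Hom-finite (each $\mathrm{Hom}_{\mathcal{T}}(X,Y)$ is a finitely generated $R$-module) and Krull–Schmidt (each object is a finite direct sum of indecomposable objects with local endomorphism rings). Then $\mathcal{X}\mapsto(\mathcal{X},\ \mathcal{X}^\perp[-1]\cap\mathcal{X}^\wedge)$ is a bijection $\mathbf{C}_4\to\mathbf{C}_3$ with inverse $\mathbf{C}_3\to\mathbf{C}_4$, $(\mathcal{X},\mathcal{Y})\mapsto\mathcal{X}$.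 -/

import Mathlib

open CategoryTheory Limits Pretriangulated

universe w v u

namespace TriangAB

section Definitions

/- Classes of objects are `ObjectProperty C`, ordered by inclusion. `P.shift n` is the class of
all `Z` with `Z⟦n⟧ ∈ P`, so it is the class usually written `P[-n]`. `P.extensionProduct Q` is
`P * Q`, and "closed under direct summands" is `P.IsStableUnderRetracts` (in a triangulated
category the retracts of an object are its direct summands). -/

variable {C : Type u} [Category.{v} C] [HasZeroObject C] [HasShift C ℤ] [Preadditive C]
  [∀ n : ℤ, (shiftFunctor C n).Additive] [Pretriangulated C]

/-- A (full) subcategory: additive and closed under isomorphisms. -/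
structure IsSubcategory (P : ObjectProperty C) : Prop where
  iso_closed : P.IsClosedUnderIsomorphisms
  zero_mem : P.ContainsZero
  biprod_mem : ∀ ⦃A B : C⦄, P A → P B → P (A ⊞ B)

/-- `add P`: the smallest subcategory containing `P` which is closed under finite direct sums
and direct summands. -/
def addClosure (P : ObjectProperty C) : ObjectProperty C := fun Z =>
  ∀ Q : ObjectProperty C, IsSubcategory Q → Q.IsStableUnderRetracts → P ≤ Q → Q Z

/-- The smallest thick (i.e. triangulated and closed under direct summands) subcategory
containing `P`. -/
def thickClosure (P : ObjectProperty C) : ObjectProperty C := fun Z =>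
  ∀ Q : ObjectProperty C, Q.IsTriangulated → Q.IsStableUnderRetracts → P ≤ Q → Q Z

/-- Closed under extensions: `P * P ⊆ P`. -/
def ClosedUnderExtensions (P : ObjectProperty C) : Prop :=
  P.extensionProduct P ≤ P

/-- A suspended class: nonempty, closed under `[1]` and under extensions. -/
structure IsSuspended (P : ObjectProperty C) : Prop where
  nonempty : ∃ A, P A
  shift_mem : ∀ ⦃A : C⦄, P A → P (A⟦(1 : ℤ)⟧)
  ext_closed : ClosedUnderExtensions P

/-- A cosuspended class: nonempty, closed under `[-1]` and under extensions. -/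
structure IsCosuspended (P : ObjectProperty C) : Prop where
  nonempty : ∃ A, P A
  shift_mem : ∀ ⦃A : C⦄, P A → P (A⟦(-1 : ℤ)⟧)
  ext_closed : ClosedUnderExtensions P

/-- The classes `ε^∧_n(P)`: `ε^∧_0(P) = P`, and `Z ∈ ε^∧_{n+1}(P)` if there is a distinguished
triangle `W ⟶ X ⟶ Z ⟶ W[1]` with `W ∈ ε^∧_n(P)` and `X ∈ P`. -/
def resClass (P : ObjectProperty C) : ℕ → ObjectProperty C
  | 0 => P
  | n + 1 => fun Z => ∃ (W X : C) (f : W ⟶ X) (g : X ⟶ Z) (h : Z ⟶ W⟦(1 : ℤ)⟧),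
      Triangle.mk f g h ∈ distTriang C ∧ resClass P n W ∧ P X

/-- `P^∧`, the union of all `ε^∧_n(P)`. -/
def wedge (P : ObjectProperty C) : ObjectProperty C := fun Z => ∃ n : ℕ, resClass P n Z

/-- The `P`-injective dimension of `M`: the least natural number `n` such that
`Hom(-, M[i])` vanishes on `P` for all `i > n`, and `∞` if there is none. -/
noncomputable def injDim (P : ObjectProperty C) (M : C) : ℕ∞ :=
  sInf {d : ℕ∞ | ∃ n : ℕ, d = (n : ℕ∞) ∧
    ∀ i : ℕ, n < i → P.rightOrthogonal (M⟦(i : ℤ)⟧)}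

/-- The `P`-injective dimension of a class `Q`, the supremum over its objects. -/
noncomputable def injDimClass (P Q : ObjectProperty C) : ℕ∞ :=
  ⨆ (M : C) (_ : Q M), injDim P M

/-- `Q` is `P`-injective. -/
def IsRelInjective (P Q : ObjectProperty C) : Prop := injDimClass P Q = 0

/-- `Q` is a weak-cogenerator in `P`: `Q ⊆ P ⊆ P[-1] * Q`. -/
def IsWeakCogenerator (P Q : ObjectProperty C) : Prop :=
  Q ≤ P ∧ P ≤ (P.shift (1 : ℤ)).extensionProduct Q

/-- `f : X ⟶ Z` is a `P`-precover of `Z`. -/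
def IsPrecover (P : ObjectProperty C) {X Z : C} (f : X ⟶ Z) : Prop :=
  P X ∧ ∀ ⦃X' : C⦄, P X' → ∀ g : X' ⟶ Z, ∃ g' : X' ⟶ X, g' ≫ f = g

/-- `P` is precovering in `Q`: every object of `Q` has a `P`-precover. -/
def IsPrecoveringIn (P Q : ObjectProperty C) : Prop :=
  ∀ ⦃Z : C⦄, Q Z → ∃ (X : C) (f : X ⟶ Z), IsPrecover P f

/-- `(A, B)` is a co-`t`-structure on the thick (strictly full triangulated) subcategory `U`.
A triangle in `U` is distinguished if and only if it is so in the ambient category, so `A * B` may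
be formed there; for `U = ⊤` this is a co-`t`-structure on the whole category. -/
structure IsCoTStructureOn (U A B : ObjectProperty C) : Prop where
  left_le : A ≤ U
  right_le : B ≤ U
  left_subcategory : IsSubcategory A
  right_subcategory : IsSubcategory B
  left_summands : A.IsStableUnderRetracts
  right_summands : B.IsStableUnderRetracts
  left_shift : ∀ ⦃X : C⦄, A X → A (X⟦(-1 : ℤ)⟧)
  right_shift : ∀ ⦃Y : C⦄, B Y → B (Y⟦(1 : ℤ)⟧)
  hom_zero : ∀ ⦃X Y : C⦄, A.shift (1 : ℤ) X → B Y → ∀ f : X ⟶ Y, f = 0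
  decomposition : U = (A.shift (1 : ℤ)).extensionProduct B

/-- `(X, Y)` is a relative Auslander-Buchweitz context. -/
structure IsRelABContext (X Y : ObjectProperty C) : Prop where
  left_cosuspended : IsCosuspended X
  left_summands : X.IsStableUnderRetracts
  right_suspended : IsSuspended Y
  right_summands : Y.IsStableUnderRetracts
  right_le : Y ≤ wedge X
  injective : IsRelInjective X (X ⊓ Y)
  cogenerator : IsWeakCogenerator X (X ⊓ Y)

variable (C)

/-- Pairs `(X, ω)` closed under direct summands, with `X` cosuspended and `ω` an `X`-injective
weak-cogenerator in `X`. -/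
def cogeneratorPairs : Set (ObjectProperty C × ObjectProperty C) :=
  {p | p.1.IsStableUnderRetracts ∧ p.2.IsStableUnderRetracts ∧ IsCosuspended p.1 ∧
    IsRelInjective p.1 p.2 ∧ IsWeakCogenerator p.1 p.2}

/-- The relative Auslander-Buchweitz contexts. -/
def relABContexts : Set (ObjectProperty C × ObjectProperty C) :=
  {p | IsRelABContext p.1 p.2}

/-- Pairs `(X, Y)` which are a co-`t`-structure on the thick closure of `X`. -/
def coTStructures : Set (ObjectProperty C × ObjectProperty C) :=
  {p | IsCoTStructureOn (thickClosure p.1) p.1 p.2}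

/-- Cosuspended classes `X = add X` which are precovering in `X^∧`. -/
def precoveringClasses : Set (ObjectProperty C) :=
  {X | IsCosuspended X ∧ IsPrecoveringIn X (wedge X) ∧ X = addClosure X}

/-- Krull-Schmidt: every object is a finite direct sum of indecomposable objects with local
endomorphism rings (the zero object being the empty sum). -/
def IsKrullSchmidt : Prop :=
  ∀ Z : C, ∃ (n : ℕ) (F : Fin n → C),
    (∀ i, Indecomposable (F i) ∧ IsLocalRing (End (F i))) ∧ Nonempty (Z ≅ ⨁ F)

/-- Hom-finite over `R`. -/
def IsHomFinite (R : Type w) [CommRing R] [Linear R C] : Prop :=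
  ∀ X Y : C, Module.Finite R (X ⟶ Y)

end Definitions

end TriangAB

/-!
Everything rests on one computation: for a cosuspended class `X` closed under retracts, the class
`X^∧` is the union of the `X[n]`, so it is triangulated, closed under retracts, and equal to the
thick closure of `X` (`IsCosuspended.wedge_iff`, `IsCosuspended.thickClosure_eq`). Let
`Y = X^⊥[-1] ∩ X^∧` be the class of `X`-injective objects of `X^∧` (`injectiveObjects`).

If `ω` is an `X`-injective weak-cogenerator in `X`, then `X ∩ Y = ω`, because the cogenerator
triangle of an object of `X ∩ Y` splits. Climbing along the `X[n]`, and applying the cogenerator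
condition once per step, gives `X^∧ ⊆ X[-1] * ω^∧`
(`IsCosuspended.wedge_le_extensionProduct`). This decomposition shows that `ω^∧` is the only
suspended class in `X^∧` that meets `X` in `ω` (`IsCosuspended.eq_wedge`). Hence
`ω^∧ = Y`, and the right class of every relative Auslander-Buchweitz context is `Y` as well. The
right class of a co-`t`-structure on the thick closure of `X` is `Y` by the usual orthogonality
argument, so contexts and co-`t`-structures are the same pairs: both amount to
`X^∧ = X[-1] * Y` (`IsCosuspended.isCoTStructureOn`, `IsCoTStructureOn.isRelABContext`).

For precovering classes the decomposition comes from a right minimal precover `A ⟶ Z[1]`: its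
cocone is `X`-injective by Wakamatsu's lemma (`IsPrecover.rightOrthogonal_shift`). Right minimal
precovers exist in a Krull-Schmidt category (`IsPrecover.exists_isRightMinimal`): take a precover
`f` whose source has the least number of indecomposable summands. An endomorphism killed by `f`
then has only non-invertible diagonal entries, for otherwise a summand could be dropped, and a
right ideal of such endomorphisms consists of elements `g` with `1 - g` invertible.
-/

set_option linter.unusedSectionVars false

namespace TriangAB

variable {C : Type u} [Category.{v} C] [HasZeroObject C] [HasShift C ℤ] [Preadditive C]
  [∀ n : ℤ, (shiftFunctor C n).Additive] [Pretriangulated C]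

/-! ### Shifts and extension products of classes of objects -/

section Classes

variable {P Q P' Q' : ObjectProperty C}

lemma extensionProduct_mono (hP : P ≤ P') (hQ : Q ≤ Q') :
    P.extensionProduct Q ≤ P'.extensionProduct Q' :=
  (ObjectProperty.monotone_extensionProduct_left Q hP).trans
    (ObjectProperty.monotone_extensionProduct_right P' hQ)

lemma shift_mono (a : ℤ) (h : P ≤ Q) : P.shift a ≤ Q.shift a := fun Z hZ => h (Z⟦a⟧) hZ

lemma shift_neg_shift [P.IsClosedUnderIsomorphisms] (a : ℤ) : (P.shift a).shift (-a) = P := by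
  rw [P.shift_shift (-a) a 0 (by simp), P.shift_zero]

lemma shift_shift_neg [P.IsClosedUnderIsomorphisms] (a : ℤ) : (P.shift (-a)).shift a = P := by
  rw [P.shift_shift a (-a) 0 (by simp), P.shift_zero]

instance isStableUnderRetracts_shift [P.IsStableUnderRetracts] (a : ℤ) :
    (P.shift a).IsStableUnderRetracts where
  of_retract r h := P.prop_of_retract (r.map (shiftFunctor C a)) h

instance isStableUnderRetracts_inf [P.IsStableUnderRetracts] [Q.IsStableUnderRetracts] :
    (P ⊓ Q).IsStableUnderRetracts where
  of_retract r h := ⟨P.prop_of_retract r h.1, Q.prop_of_retract r h.2⟩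

instance isStableUnderRetracts_rightOrthogonal :
    P.rightOrthogonal.IsStableUnderRetracts where
  of_retract r h A f hA := by
    rw [← Category.comp_id f, ← r.retract, ← Category.assoc, h (f ≫ r.i) hA, zero_comp]

lemma extensionProduct_shift_le (a : ℤ) :
    (P.shift a).extensionProduct (Q.shift a) ≤ (P.extensionProduct Q).shift a := by
  rintro Z ⟨A, B, f, g, h, hT, hA, hB⟩
  exact ⟨_, _, _, _, _, Triangle.shift_distinguished _ hT a, hA, hB⟩

lemma shift_extensionProduct_le [P.IsClosedUnderIsomorphisms] [Q.IsClosedUnderIsomorphisms]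
    (a : ℤ) : (P.extensionProduct Q).shift a ≤ (P.shift a).extensionProduct (Q.shift a) := by
  conv_lhs => rw [← shift_neg_shift (P := P) a, ← shift_neg_shift (P := Q) a]
  refine (shift_mono a (extensionProduct_shift_le (-a))).trans ?_
  rw [shift_shift_neg]

lemma ClosedUnderExtensions.shift (h : ClosedUnderExtensions P) (a : ℤ) :
    ClosedUnderExtensions (P.shift a) :=
  (extensionProduct_shift_le a).trans (shift_mono a h)

lemma closedUnderExtensions_rightOrthogonal (P : ObjectProperty C) :
    ClosedUnderExtensions P.rightOrthogonal :=
  ObjectProperty.extensionProduct_le_of_isTriangulatedClosed₂ le_rfl le_rfl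

lemma ClosedUnderExtensions.inf (hP : ClosedUnderExtensions P) (hQ : ClosedUnderExtensions Q) :
    ClosedUnderExtensions (P ⊓ Q) := fun Z hZ =>
  ⟨hP Z (extensionProduct_mono inf_le_left inf_le_left Z hZ),
    hQ Z (extensionProduct_mono inf_le_right inf_le_right Z hZ)⟩

lemma ClosedUnderExtensions.biprod_mem (hP : ClosedUnderExtensions P) {A B : C} (hA : P A)
    (hB : P B) : P (A ⊞ B) :=
  hP _ ⟨_, _, _, _, _, binaryBiproductTriangle_distinguished A B, hA, hB⟩

/-- `Hom(P[-1], Z) = 0` if and only if `Hom(P, Z[1]) = 0`. -/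
lemma rightOrthogonal_shift_one [P.IsClosedUnderIsomorphisms] :
    P.rightOrthogonal.shift (1 : ℤ) = (P.shift (1 : ℤ)).rightOrthogonal := by
  ext Z
  constructor
  · intro h A f hA
    exact (shiftFunctor C (1 : ℤ)).map_injective (by rw [h (f⟦(1 : ℤ)⟧') hA, Functor.map_zero])
  · intro h A f hA
    let e := shiftNegShift A (1 : ℤ)
    obtain ⟨g, hg⟩ := (shiftFunctor C (1 : ℤ)).map_surjective (e.hom ≫ f)
    have hg0 : g = 0 := h g (P.prop_of_iso e.symm hA)
    rw [hg0, Functor.map_zero] at hg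
    exact (cancel_epi e.hom).1 (by rw [← hg, comp_zero])

end Classes

section Retracts

variable {T : Triangle C}

lemma nonempty_retract₂₃ (hT : T ∈ distTriang C) (h : T.mor₁ = 0) :
    Nonempty (Retract T.obj₂ T.obj₃) := by
  obtain ⟨r, hr⟩ := Triangle.yoneda_exact₂ _ hT (𝟙 T.obj₂) (by simp [h])
  exact ⟨⟨T.mor₂, r, hr.symm⟩⟩

lemma nonempty_retract₂₁ (hT : T ∈ distTriang C) (h : T.mor₂ = 0) :
    Nonempty (Retract T.obj₂ T.obj₁) := by
  obtain ⟨r, hr⟩ := Triangle.coyoneda_exact₂ _ hT (𝟙 T.obj₂) (by simp [h])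
  exact ⟨⟨r, T.mor₁, hr.symm⟩⟩

end Retracts

/-! ### The class `P^∧` -/

section Wedge

variable {P Q : ObjectProperty C}

lemma resClass_succ [P.IsClosedUnderIsomorphisms] (n : ℕ)
    [(resClass P n).IsClosedUnderIsomorphisms] :
    resClass P (n + 1) = P.extensionProduct ((resClass P n).shift (-1 : ℤ)) := by
  ext Z
  constructor
  · rintro ⟨W, A, f, g, h, hT, hW, hA⟩
    exact ⟨_, _, _, _, _, rot_of_distTriang _ hT, hA,
      (resClass P n).prop_of_iso (shiftShiftNeg W (1 : ℤ)).symm hW⟩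
  · rintro ⟨A, V, f, g, h, hT, hA, hV⟩
    exact ⟨_, _, _, _, _, inv_rot_of_distTriang _ hT, hV, hA⟩

instance isClosedUnderIsomorphisms_resClass [P.IsClosedUnderIsomorphisms] (n : ℕ) :
    (resClass P n).IsClosedUnderIsomorphisms := by
  induction n with
  | zero => exact inferInstanceAs P.IsClosedUnderIsomorphisms
  | succ n ih =>
    rw [resClass_succ]
    infer_instance

instance isClosedUnderIsomorphisms_wedge [P.IsClosedUnderIsomorphisms] :
    (wedge P).IsClosedUnderIsomorphisms where
  of_iso e h := ⟨h.choose, (resClass P _).prop_of_iso e h.choose_spec⟩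

lemma le_wedge : P ≤ wedge P := fun _ h => ⟨0, h⟩

lemma IsSuspended.shift_neg_one_le [Q.IsClosedUnderIsomorphisms] (hQ : IsSuspended Q) :
    Q.shift (-1 : ℤ) ≤ Q := fun Z hZ =>
  Q.prop_of_iso (shiftNegShift Z (1 : ℤ)) (hQ.shift_mem hZ)

lemma IsSuspended.wedge_le [P.IsClosedUnderIsomorphisms] [Q.IsClosedUnderIsomorphisms]
    (hQ : IsSuspended Q) (h : P ≤ Q) : wedge P ≤ Q := by
  rintro Z ⟨n, hn⟩
  induction n generalizing Z with
  | zero => exact h Z hn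
  | succ n ih =>
    rw [resClass_succ] at hn
    exact hQ.ext_closed Z
      (extensionProduct_mono h ((shift_mono _ ih).trans hQ.shift_neg_one_le) Z hn)

end Wedge

/-! ### Cosuspended classes -/

section Cosuspended

variable {X : ObjectProperty C}

lemma IsCosuspended.containsZero [X.IsStableUnderRetracts] (hX : IsCosuspended X) :
    X.ContainsZero :=
  have : X.Nonempty := ⟨hX.nonempty⟩
  inferInstance

lemma IsCosuspended.shift_antitone [X.IsStableUnderRetracts] (hX : IsCosuspended X)
    {a b : ℤ} (hab : a ≤ b) : X.shift b ≤ X.shift a := by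
  obtain ⟨n, rfl⟩ := Int.le.dest hab
  clear hab
  induction n with
  | zero => simp
  | succ n ih =>
    refine le_trans ?_ ih
    rw [← X.shift_shift (a + (n + 1 : ℕ)) (-1) (a + n) (by push_cast; ring)]
    exact shift_mono _ fun Z hZ => hX.shift_mem hZ

/-- For a cosuspended class `X`, the class `X^∧` is the union of the `X[n]`. -/
lemma IsCosuspended.resClass_eq [X.IsStableUnderRetracts] (hX : IsCosuspended X) (n : ℕ) :
    resClass X n = X.shift (-(n : ℤ)) := by
  have := hX.containsZero
  induction n with
  | zero => simp [resClass]
  | succ n ih =>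
    rw [resClass_succ, ih, X.shift_shift (-1) (-(n : ℤ)) (-((n + 1 : ℕ) : ℤ))
      (by push_cast; ring)]
    refine le_antisymm ?_ (ObjectProperty.le_extensionProduct_right X)
    refine (extensionProduct_mono ?_ le_rfl).trans (hX.ext_closed.shift _)
    conv_lhs => rw [← X.shift_zero ℤ]
    exact hX.shift_antitone (by omega)

lemma IsCosuspended.wedge_iff [X.IsStableUnderRetracts] (hX : IsCosuspended X) (Z : C) :
    wedge X Z ↔ ∃ a : ℤ, X.shift a Z := by
  constructor
  · rintro ⟨n, hn⟩
    rw [hX.resClass_eq] at hn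
    exact ⟨_, hn⟩
  · rintro ⟨a, ha⟩
    refine ⟨a.natAbs, ?_⟩
    rw [hX.resClass_eq]
    exact hX.shift_antitone (by omega) Z ha

lemma IsCosuspended.isStableUnderRetracts_wedge [X.IsStableUnderRetracts]
    (hX : IsCosuspended X) : (wedge X).IsStableUnderRetracts where
  of_retract r h := by
    rw [hX.wedge_iff] at h ⊢
    exact h.imp fun a ha => (X.shift a).prop_of_retract r ha

lemma IsCosuspended.isTriangulated_wedge [X.IsStableUnderRetracts] (hX : IsCosuspended X) :
    (wedge X).IsTriangulated := by
  have := hX.containsZero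
  exact
  { exists_zero := ⟨_, isZero_zero C, le_wedge _ X.prop_zero⟩
    isStableUnderShiftBy a := ⟨fun Z hZ => by
      rw [hX.wedge_iff] at hZ
      obtain ⟨b, hb⟩ := hZ
      refine (hX.wedge_iff _).2 ⟨b - a, ?_⟩
      rw [← X.shift_shift a (b - a) b (by ring)] at hb
      exact hb⟩
    toIsTriangulatedClosed₂ := .mk' fun T hT h₁ h₃ => by
      rw [hX.wedge_iff] at h₁ h₃
      obtain ⟨a, ha⟩ := h₁
      obtain ⟨b, hb⟩ := h₃
      exact (hX.wedge_iff _).2 ⟨min a b, hX.ext_closed.shift _ _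
        ⟨_, _, _, _, _, hT, hX.shift_antitone (min_le_left a b) _ ha,
          hX.shift_antitone (min_le_right a b) _ hb⟩⟩ }

lemma IsCosuspended.thickClosure_eq [X.IsStableUnderRetracts] (hX : IsCosuspended X) :
    thickClosure X = wedge X := by
  refine le_antisymm
    (fun Z hZ => hZ _ hX.isTriangulated_wedge hX.isStableUnderRetracts_wedge le_wedge) ?_
  intro Z hZ Q hQ hQ' hXQ
  have hQs : IsSuspended Q :=
    ⟨hX.nonempty.imp hXQ, fun A hA => Q.le_shift 1 A hA,
      ObjectProperty.extensionProduct_le_of_isTriangulatedClosed₂ le_rfl le_rfl⟩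
  exact hQs.wedge_le hXQ Z hZ

lemma IsCosuspended.shift_one_le [X.IsStableUnderRetracts] (hX : IsCosuspended X) :
    X.shift (1 : ℤ) ≤ X := by
  conv_rhs => rw [← X.shift_zero ℤ]
  exact hX.shift_antitone (by norm_num)

lemma IsCosuspended.rightOrthogonal_shift [X.IsStableUnderRetracts] (hX : IsCosuspended X)
    {M : C} (hM : X.rightOrthogonal M) : X.rightOrthogonal (M⟦(1 : ℤ)⟧) := by
  change X.rightOrthogonal.shift (1 : ℤ) M
  rw [rightOrthogonal_shift_one]
  exact fun A f hA => hM f (hX.shift_one_le A hA)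

end Cosuspended

/-! ### Relative injectivity -/

section Injective

variable {X Q : ObjectProperty C}

lemma injDim_eq_zero_iff {M : C} :
    injDim X M = 0 ↔ ∀ i : ℕ, 0 < i → X.rightOrthogonal (M⟦(i : ℤ)⟧) := by
  constructor
  · intro h
    by_cases hS : {d : ℕ∞ | ∃ n : ℕ, d = (n : ℕ∞) ∧
        ∀ i : ℕ, n < i → X.rightOrthogonal (M⟦(i : ℤ)⟧)}.Nonempty
    · obtain ⟨n, hn, hi⟩ := csInf_mem hS
      change injDim X M = n at hn
      rw [h] at hn
      obtain rfl : n = 0 := by exact_mod_cast hn.symm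
      exact hi
    · rw [Set.not_nonempty_iff_eq_empty] at hS
      simp [injDim, hS] at h
  · intro h
    exact le_antisymm (sInf_le ⟨0, rfl, h⟩) zero_le

lemma IsCosuspended.isRelInjective_iff [X.IsStableUnderRetracts] (hX : IsCosuspended X) :
    IsRelInjective X Q ↔ Q ≤ X.rightOrthogonal.shift (1 : ℤ) := by
  simp only [IsRelInjective, injDimClass, ← nonpos_iff_eq_zero, iSup_le_iff]
  simp only [nonpos_iff_eq_zero, injDim_eq_zero_iff]
  refine ⟨fun h M hM => h M hM 1 one_pos, fun h M hM i hi => ?_⟩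
  induction i, hi using Nat.le_induction with
  | base => exact h M hM
  | succ i hi ih =>
    exact X.rightOrthogonal.prop_of_iso ((shiftFunctorAdd' C (i : ℤ) 1 ((i + 1 : ℕ) : ℤ)
      (by push_cast; rfl)).symm.app M) (hX.rightOrthogonal_shift ih)

/-- The `X`-injective objects `X^⊥[-1] ∩ X^∧` of `X^∧`. -/
def injectiveObjects (X : ObjectProperty C) : ObjectProperty C :=
  X.rightOrthogonal.shift (1 : ℤ) ⊓ wedge X

lemma IsCosuspended.isStableUnderRetracts_injectiveObjects [X.IsStableUnderRetracts]
    (hX : IsCosuspended X) : (injectiveObjects X).IsStableUnderRetracts :=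
  have := hX.isStableUnderRetracts_wedge
  isStableUnderRetracts_inf

lemma IsCosuspended.isSuspended_injectiveObjects [X.IsStableUnderRetracts]
    (hX : IsCosuspended X) : IsSuspended (injectiveObjects X) := by
  have := hX.isTriangulated_wedge
  refine ⟨⟨_, fun A f _ => ((shiftFunctor C (1 : ℤ)).map_isZero
      (isZero_zero C)).eq_of_tgt _ _, ?_⟩, ?_, ?_⟩
  · exact (wedge X).prop_zero
  · exact fun A hA => ⟨hX.rightOrthogonal_shift hA.1, (wedge X).le_shift 1 A hA.2⟩
  · exact ((closedUnderExtensions_rightOrthogonal X).shift 1).inf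
      (ObjectProperty.extensionProduct_le_of_isTriangulatedClosed₂ le_rfl le_rfl)

end Injective

/-! ### Weak-cogenerators and Auslander-Buchweitz contexts -/

section Cogenerators

variable {X Y ω : ObjectProperty C}

lemma IsCosuspended.inf_injectiveObjects_eq [X.IsStableUnderRetracts] [ω.IsStableUnderRetracts]
    (hX : IsCosuspended X) (hω : IsRelInjective X ω) (hc : IsWeakCogenerator X ω) :
    X ⊓ injectiveObjects X = ω := by
  rw [hX.isRelInjective_iff] at hω
  refine le_antisymm ?_ fun Z hZ => ⟨hc.1 Z hZ, hω Z hZ, le_wedge Z (hc.1 Z hZ)⟩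
  rintro Z ⟨hZ, hZ', -⟩
  obtain ⟨A, W, f, g, h, hT, hA, hW⟩ := hc.2 Z hZ
  rw [rightOrthogonal_shift_one] at hZ'
  obtain ⟨r⟩ := nonempty_retract₂₃ hT (hZ' f hA)
  exact ω.prop_of_retract r hW

/-- Every object of `X^∧` is an extension of an object of `ω^∧` by one of `X[-1]`. The length of
the resolution is lowered by shifting, and the cogenerator condition is applied once per step. -/
lemma IsCosuspended.wedge_le_extensionProduct [IsTriangulated C] [X.IsStableUnderRetracts]
    [ω.IsStableUnderRetracts] (hX : IsCosuspended X) (hc : IsWeakCogenerator X ω) :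
    wedge X ≤ (X.shift (1 : ℤ)).extensionProduct (wedge ω) := by
  have key (n : ℕ) : resClass X n ≤ (X.shift (1 : ℤ)).extensionProduct (resClass ω n) := by
    induction n with
    | zero => exact hc.2
    | succ n ih =>
      calc resClass X (n + 1) = (resClass X n).shift (-1) := by
            rw [hX.resClass_eq, hX.resClass_eq, X.shift_shift (-1) (-(n : ℤ)) (-((n + 1 : ℕ) : ℤ))
              (by push_cast; ring)]
        _ ≤ ((X.shift (1 : ℤ)).extensionProduct (resClass ω n)).shift (-1) := shift_mono _ ih
        _ ≤ ((X.shift (1 : ℤ)).shift (-1)).extensionProduct ((resClass ω n).shift (-1)) :=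
            shift_extensionProduct_le _
        _ ≤ ((X.shift (1 : ℤ)).extensionProduct ω).extensionProduct
              ((resClass ω n).shift (-1)) := by
            rw [shift_neg_shift]
            exact extensionProduct_mono hc.2 le_rfl
        _ = (X.shift (1 : ℤ)).extensionProduct (resClass ω (n + 1)) := by
            rw [ObjectProperty.extensionProduct_assoc, resClass_succ]
  rintro Z ⟨n, hn⟩
  exact extensionProduct_mono le_rfl (fun W hW => ⟨n, hW⟩) Z (key n Z hn)

/-- The class `ω^∧` is the only suspended class in `X^∧` which meets `X` in `ω`. -/
lemma IsCosuspended.eq_wedge [IsTriangulated C] [X.IsStableUnderRetracts]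
    [Y.IsStableUnderRetracts] (hX : IsCosuspended X) (hY : IsSuspended Y) (hYX : Y ≤ wedge X)
    (hc : IsWeakCogenerator X (X ⊓ Y)) : Y = wedge (X ⊓ Y) := by
  have hle : wedge (X ⊓ Y) ≤ Y := hY.wedge_le inf_le_right
  refine le_antisymm (fun Z hZ => ?_) hle
  have := hX.isTriangulated_wedge
  obtain ⟨A, W, f, g, h, hT, hA, hW⟩ :=
    hX.wedge_le_extensionProduct hc _ ((wedge X).le_shift (-1) Z (hYX Z hZ))
  -- Two rotations give `W ⟶ A[1] ⟶ Z ⟶ W[1]`, so `A[1]` is an extension of objects of `Y`.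
  have hT' := rot_of_distTriang _ (rot_of_distTriang _ hT)
  have e := shiftNegShift Z (1 : ℤ)
  have hA' : Y (A⟦(1 : ℤ)⟧) :=
    hY.ext_closed _ ⟨_, _, _, _, _, hT', hle W hW, Y.prop_of_iso e.symm hZ⟩
  obtain ⟨n, hn⟩ := hW
  exact (wedge (X ⊓ Y)).prop_of_iso e ⟨n + 1, _, _, _, _, _, hT', hn, hA, hA'⟩

lemma IsCosuspended.wedge_eq_injectiveObjects [IsTriangulated C] [X.IsStableUnderRetracts]
    [ω.IsStableUnderRetracts] (hX : IsCosuspended X) (hω : IsRelInjective X ω)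
    (hc : IsWeakCogenerator X ω) : wedge ω = injectiveObjects X := by
  have := hX.isStableUnderRetracts_injectiveObjects
  have h := hX.inf_injectiveObjects_eq hω hc
  rw [hX.eq_wedge hX.isSuspended_injectiveObjects inf_le_right (by rwa [h]), h]

lemma IsRelABContext.eq_injectiveObjects [IsTriangulated C] (h : IsRelABContext X Y) :
    Y = injectiveObjects X := by
  have := h.left_summands
  have := h.right_summands
  rw [← h.left_cosuspended.wedge_eq_injectiveObjects h.injective h.cogenerator]
  exact h.left_cosuspended.eq_wedge h.right_suspended h.right_le h.cogenerator

end Cogenerators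

/-! ### Co-`t`-structures -/

section CoTStructures

variable {X Y U : ObjectProperty C}

lemma IsSubcategory.containsZero {P : ObjectProperty C} (h : IsSubcategory P) :
    P.ContainsZero := h.zero_mem

lemma isSubcategory_of_closedUnderExtensions {P : ObjectProperty C} [P.IsStableUnderRetracts]
    (hne : ∃ A, P A) (h : ClosedUnderExtensions P) : IsSubcategory P where
  iso_closed := inferInstance
  zero_mem :=
    have : P.Nonempty := ⟨hne⟩
    inferInstance
  biprod_mem _ _ hA hB := h.biprod_mem hA hB

lemma IsCoTStructureOn.le_orthogonal (h : IsCoTStructureOn U X Y) :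
    Y ≤ X.rightOrthogonal.shift (1 : ℤ) := by
  have := h.left_summands
  rw [rightOrthogonal_shift_one]
  exact fun B hB A f hA => h.hom_zero hA hB f

lemma IsCoTStructureOn.right_eq (h : IsCoTStructureOn U X Y) :
    Y = X.rightOrthogonal.shift (1 : ℤ) ⊓ U := by
  have := h.left_summands
  have := h.right_summands
  refine le_antisymm (le_inf h.le_orthogonal h.right_le) ?_
  rintro Z ⟨hZ, hZU⟩
  rw [h.decomposition] at hZU
  obtain ⟨A, B, f, g, k, hT, hA, hB⟩ := hZU
  rw [rightOrthogonal_shift_one] at hZ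
  obtain ⟨r⟩ := nonempty_retract₂₃ hT (hZ f hA)
  exact Y.prop_of_retract r hB

/-- The left class of a co-`t`-structure on `U` consists of the `Z` in `U` with
`Hom(Z[-1], Y) = 0`. -/
lemma IsCoTStructureOn.left_iff (h : IsCoTStructureOn U X Y) [U.IsTriangulated] (Z : C) :
    X Z ↔ U Z ∧ Y.leftOrthogonal (Z⟦(-1 : ℤ)⟧) := by
  have := h.left_summands
  constructor
  · refine fun hZ => ⟨h.left_le Z hZ, fun B f hB => h.hom_zero ?_ hB f⟩
    exact X.prop_of_iso (shiftNegShift Z (1 : ℤ)).symm hZ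
  · rintro ⟨hZU, hZ⟩
    have hZU' := U.le_shift (-1) Z hZU
    rw [h.decomposition] at hZU'
    obtain ⟨A, B, f, g, k, hT, hA, hB⟩ := hZU'
    obtain ⟨r⟩ := nonempty_retract₂₁ hT (hZ g hB)
    exact X.prop_of_iso (shiftNegShift Z (1 : ℤ))
      (X.prop_of_retract (r.map (shiftFunctor C (1 : ℤ))) hA)

lemma IsCoTStructureOn.left_cosuspended (h : IsCoTStructureOn U X Y) [U.IsTriangulated]
    [U.IsClosedUnderIsomorphisms] : IsCosuspended X := by
  have := h.left_subcategory.containsZero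
  have := h.left_summands
  refine ⟨⟨_, X.prop_zero⟩, h.left_shift, ?_⟩
  rintro Z ⟨A, B, f, g, k, hT, hA, hB⟩
  rw [h.left_iff] at hA hB ⊢
  exact ⟨U.ext_of_isTriangulatedClosed₂ _ hT hA.1 hB.1,
    Y.leftOrthogonal.ext_of_isTriangulatedClosed₂ _ (Triangle.shift_distinguished _ hT (-1))
      hA.2 hB.2⟩

instance isTriangulated_thickClosure (X : ObjectProperty C) : (thickClosure X).IsTriangulated := by
  have hiso {Q : ObjectProperty C} (hQ : Q.IsStableUnderRetracts) :
    Q.IsClosedUnderIsomorphisms := inferInstance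
  have : (thickClosure X).IsClosedUnderIsomorphisms :=
    ⟨fun e h Q hQ hQ' hXQ => (hiso hQ').of_iso e (h Q hQ hQ' hXQ)⟩
  exact
  { exists_zero := ⟨_, isZero_zero C, fun Q hQ hQ' _ =>
      have := hiso hQ'
      Q.prop_zero⟩
    isStableUnderShiftBy a := ⟨fun Z hZ Q hQ hQ' hXQ => Q.le_shift a Z (hZ Q hQ hQ' hXQ)⟩
    toIsTriangulatedClosed₂ := .mk' fun T hT h₁ h₃ Q hQ hQ' hXQ =>
      have := hiso hQ'
      Q.ext_of_isTriangulatedClosed₂ T hT (h₁ Q hQ hQ' hXQ) (h₃ Q hQ hQ' hXQ) }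

instance isStableUnderRetracts_thickClosure (X : ObjectProperty C) :
    (thickClosure X).IsStableUnderRetracts where
  of_retract r h Q hQ hQ' hXQ := Q.prop_of_retract r (h Q hQ hQ' hXQ)

lemma IsCoTStructureOn.eq_injectiveObjects (h : IsCoTStructureOn (thickClosure X) X Y) :
    Y = injectiveObjects X := by
  have := h.left_summands
  rw [injectiveObjects, ← h.left_cosuspended.thickClosure_eq]
  exact h.right_eq

lemma IsCoTStructureOn.isRelABContext (h : IsCoTStructureOn (thickClosure X) X Y) :
    IsRelABContext X Y := by
  have := h.left_summands
  have hX := h.left_cosuspended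
  have hY := h.eq_injectiveObjects
  refine ⟨hX, h.left_summands, hY ▸ hX.isSuspended_injectiveObjects, h.right_summands,
    hX.thickClosure_eq ▸ h.right_le, ?_, inf_le_left, fun Z hZ => ?_⟩
  · exact hX.isRelInjective_iff.2 (inf_le_right.trans h.le_orthogonal)
  · have hZU := h.left_le Z hZ
    rw [h.decomposition] at hZU
    obtain ⟨A, B, f, g, k, hT, hA, hB⟩ := hZU
    exact ⟨A, B, f, g, k, hT, hA,
      hX.ext_closed B ⟨_, _, _, _, _, rot_of_distTriang _ hT, hZ, hA⟩, hB⟩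

/-- A decomposition of `X^∧` makes `X` and its injective objects a co-`t`-structure. -/
lemma IsCosuspended.isCoTStructureOn [X.IsStableUnderRetracts] (hX : IsCosuspended X)
    (hd : wedge X ≤ (X.shift (1 : ℤ)).extensionProduct (injectiveObjects X)) :
    IsCoTStructureOn (thickClosure X) X (injectiveObjects X) := by
  have := hX.isStableUnderRetracts_injectiveObjects
  have hY := hX.isSuspended_injectiveObjects
  have hU := hX.isTriangulated_wedge
  rw [hX.thickClosure_eq]
  refine ⟨le_wedge, inf_le_right, isSubcategory_of_closedUnderExtensions hX.nonempty hX.ext_closed,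
    isSubcategory_of_closedUnderExtensions hY.nonempty hY.ext_closed, inferInstance, inferInstance,
    hX.shift_mem, hY.shift_mem, fun A B hA hB f => ?_, le_antisymm hd ?_⟩
  · have hB' := hB.1
    rw [rightOrthogonal_shift_one] at hB'
    exact hB' f hA
  · exact ObjectProperty.extensionProduct_le_of_isTriangulatedClosed₂
      (hX.shift_one_le.trans le_wedge) inf_le_right

lemma IsRelABContext.isCoTStructureOn [IsTriangulated C] (h : IsRelABContext X Y) :
    IsCoTStructureOn (thickClosure X) X Y := by
  have := h.left_summands
  have := h.right_summands
  have hX := h.left_cosuspended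
  rw [h.eq_injectiveObjects]
  refine hX.isCoTStructureOn ?_
  rw [← hX.wedge_eq_injectiveObjects h.injective h.cogenerator]
  exact hX.wedge_le_extensionProduct h.cogenerator

end CoTStructures

/-! ### Minimal precovers in Krull-Schmidt categories -/

/-- If `1 - g * e i` is invertible for all `g` in a right ideal `L` and all `i`, then so is
`1 - g * ∑ e i`: the summands can be eliminated one at a time, since multiplying
`1 - g * (e i + t)` by the inverse of `1 - g * e i` gives `1 - g' * t` with `g'` in `L`. -/
lemma isUnit_one_sub_mul_sum {E ι : Type*} [Ring E] (L : AddSubgroup E)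
    (hL : ∀ g ∈ L, ∀ a, g * a ∈ L) (e : ι → E) (s : Finset ι)
    (h : ∀ g ∈ L, ∀ i ∈ s, IsUnit (1 - g * e i)) :
    ∀ g ∈ L, IsUnit (1 - g * ∑ i ∈ s, e i) := by
  classical
  induction s using Finset.induction_on with
  | empty => simp
  | insert k s hk ih =>
    intro g hg
    rw [Finset.sum_insert hk]
    obtain ⟨u, hu⟩ := h g hg k (Finset.mem_insert_self k s)
    have hinv : (↑u⁻¹ : E) = 1 + g * (e k * ↑u⁻¹) := by
      have : (1 - g * e k) * (↑u⁻¹ : E) = 1 := by rw [← hu, Units.mul_inv]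
      rw [sub_mul, one_mul, sub_eq_iff_eq_add] at this
      rw [← mul_assoc]
      exact this
    have hg' : (↑u⁻¹ : E) * g ∈ L := by
      rw [hinv, add_mul, one_mul, mul_assoc]
      exact L.add_mem hg (hL g hg _)
    have := ih (fun g hg i hi => h g hg i (Finset.mem_insert_of_mem hi)) _ hg'
    convert u.isUnit.mul this using 1
    rw [mul_sub, mul_one, ← mul_assoc, ← mul_assoc, Units.mul_inv, one_mul, hu, mul_add]
    abel

section Minimal

variable {D : Type u} [Category.{v} D] [Preadditive D]

/-- Jacobson's lemma: `1 - ab` is invertible if `1 - ba` is, with inverse `1 + a(1 - ba)⁻¹b`. -/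
lemma isIso_id_sub_comp {A B : D} (a : A ⟶ B) (b : B ⟶ A) (h : IsIso (𝟙 B - b ≫ a)) :
    IsIso (𝟙 A - a ≫ b) := by
  have h₁ := IsIso.hom_inv_id (𝟙 B - b ≫ a)
  have h₂ := IsIso.inv_hom_id (𝟙 B - b ≫ a)
  set w := inv (𝟙 B - b ≫ a)
  have h₁' : a ≫ ((𝟙 B - b ≫ a) ≫ w) ≫ b = a ≫ b := by rw [h₁, Category.id_comp]
  have h₂' : a ≫ (w ≫ (𝟙 B - b ≫ a)) ≫ b = a ≫ b := by rw [h₂, Category.id_comp]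
  simp only [Preadditive.sub_comp, Preadditive.comp_sub, Category.id_comp, Category.comp_id,
    Category.assoc] at h₁' h₂'
  refine ⟨𝟙 A + a ≫ w ≫ b, ?_, ?_⟩
  · simp only [Preadditive.comp_add, Preadditive.sub_comp, Category.id_comp, Category.comp_id,
      Category.assoc]
    rw [h₁', sub_add_cancel]
  · simp only [Preadditive.add_comp, Preadditive.comp_sub, Category.id_comp, Category.comp_id,
      Category.assoc]
    rw [sub_eq_iff_eq_add'.1 h₂']
    abel

/-- A right minimal morphism: `u ≫ f = f` forces `u` to be an isomorphism. -/
def IsRightMinimal {A Z : D} (f : A ⟶ Z) : Prop :=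
  ∀ u : A ⟶ A, u ≫ f = f → IsIso u

variable [HasFiniteBiproducts D]

/-- If some endomorphism `g` killed by a morphism `f : ⨁ F ⟶ Z` has an invertible diagonal entry
at `i`, then `f` factors through its restriction to the sum of the other `F k`. -/
lemma exists_comp_restrict_eq {n : ℕ} {F : Fin (n + 1) → D} {Z : D} {f : ⨁ F ⟶ Z}
    {g : ⨁ F ⟶ ⨁ F} (hg : g ≫ f = 0) (i : Fin (n + 1))
    (hi : IsIso (biproduct.ι F i ≫ g ≫ biproduct.π F i)) :
    ∃ r : ⨁ F ⟶ ⨁ (fun k => F (i.succAbove k)),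
      r ≫ biproduct.desc (fun k => biproduct.ι F (i.succAbove k)) ≫ f = f := by
  set t := biproduct.ι F i ≫ g ≫ biproduct.π F i with ht
  have htot : biproduct.lift (fun k => biproduct.π F (i.succAbove k)) ≫
      biproduct.desc (fun k => biproduct.ι F (i.succAbove k)) =
      𝟙 _ - biproduct.π F i ≫ biproduct.ι F i := by
    rw [biproduct.lift_desc, ← biproduct.total, Fin.sum_univ_succAbove _ i]
    simp
  -- The first factor of `r` subtracts a multiple of `g`, which does not change the composite with
  -- `f`, so as to cancel the `i`-th component.
  refine ⟨(𝟙 _ - biproduct.π F i ≫ inv t ≫ biproduct.ι F i ≫ g) ≫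
    biproduct.lift (fun k => biproduct.π F (i.succAbove k)), ?_⟩
  have h₁ : inv t ≫ biproduct.ι F i ≫ g ≫ biproduct.π F i ≫ biproduct.ι F i ≫ f =
      biproduct.ι F i ≫ f := by
    rw [IsIso.inv_comp_eq, ht]
    simp
  rw [Category.assoc, reassoc_of% htot]
  simp [Preadditive.sub_comp, Preadditive.comp_sub, hg, h₁]

lemma nonempty_retract_succAbove {n : ℕ} (F : Fin (n + 1) → D) (i : Fin (n + 1)) :
    Nonempty (Retract (⨁ (fun k => F (i.succAbove k))) (⨁ F)) := by
  refine ⟨⟨biproduct.desc (fun k => biproduct.ι F (i.succAbove k)),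
    biproduct.lift (fun k => biproduct.π F (i.succAbove k)), ?_⟩⟩
  refine biproduct.hom_ext' _ _ fun k => biproduct.hom_ext _ _ fun l => ?_
  by_cases h : k = l
  · subst h
    simp
  · simp [biproduct.ι_π_ne _ h, biproduct.ι_π_ne F (fun h' => h (i.succAbove_right_injective h'))]

end Minimal

section Krull

variable {X : ObjectProperty C}

/-- In a Krull-Schmidt category a precover whose source has the least possible number of
indecomposable summands is right minimal. -/
lemma IsPrecover.exists_isRightMinimal [X.IsStableUnderRetracts] (hC : IsKrullSchmidt C)
    {A Z : C} {f : A ⟶ Z} (hf : IsPrecover X f) :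
    ∃ (B : C) (f' : B ⟶ Z), IsPrecover X f' ∧ IsRightMinimal f' := by
  classical
  have hex : ∃ (n : ℕ) (F : Fin n → C), (∀ i, IsLocalRing (End (F i))) ∧
      ∃ f' : ⨁ F ⟶ Z, IsPrecover X f' := by
    obtain ⟨n, F, hF, ⟨e⟩⟩ := hC A
    refine ⟨n, F, fun i => (hF i).2, e.inv ≫ f, X.prop_of_iso e hf.1, fun A' hA' g => ?_⟩
    obtain ⟨g', hg'⟩ := hf.2 hA' g
    exact ⟨g' ≫ e.hom, by simpa using hg'⟩
  obtain ⟨F, hF, f', hf'⟩ := Nat.find_spec hex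
  have hmin := fun m => Nat.find_min hex (m := m)
  generalize Nat.find hex = n at F hF f' hf' hmin
  refine ⟨_, f', hf', fun u hu => ?_⟩
  -- The right ideal of endomorphisms killed by `f'`.
  let L : AddSubgroup (End (⨁ F)) :=
    { carrier := {g | (g : ⨁ F ⟶ ⨁ F) ≫ f' = 0}
      add_mem' := fun {a b} ha hb => by
        change ((a : ⨁ F ⟶ ⨁ F) + b) ≫ f' = 0
        rw [Preadditive.add_comp, show (a : ⨁ F ⟶ ⨁ F) ≫ f' = 0 from ha,
          show (b : ⨁ F ⟶ ⨁ F) ≫ f' = 0 from hb, add_zero]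
      zero_mem' := zero_comp
      neg_mem' := fun {a} ha => by
        change (-(a : ⨁ F ⟶ ⨁ F)) ≫ f' = 0
        rw [Preadditive.neg_comp, show (a : ⨁ F ⟶ ⨁ F) ≫ f' = 0 from ha, neg_zero] }
  have hL : ∀ g ∈ L, ∀ a, g * a ∈ L := fun g hg a => by
    change (a ≫ g) ≫ f' = 0
    rw [Category.assoc, show (g : ⨁ F ⟶ ⨁ F) ≫ f' = 0 from hg, comp_zero]
  let e (i : Fin n) : End (⨁ F) := biproduct.π F i ≫ biproduct.ι F i
  have hone (g : End (⨁ F)) (hg : g ∈ L) (i : Fin n) : IsUnit (1 - g * e i) := by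
    have hloc := hF i
    let t : End (F i) := biproduct.ι F i ≫ g ≫ biproduct.π F i
    have ht : IsUnit (1 - t) := by
      -- Otherwise `t` is invertible and the `i`-th summand is superfluous.
      refine (IsLocalRing.isUnit_or_isUnit_of_add_one (add_sub_cancel t 1)).resolve_left
        fun hu => ?_
      rw [isUnit_iff_isIso] at hu
      obtain _ | n := n
      · exact i.elim0
      · obtain ⟨r, hr⟩ := exists_comp_restrict_eq hg i hu
        obtain ⟨s⟩ := nonempty_retract_succAbove F i
        refine hmin n n.lt_succ_self ⟨fun k => F (i.succAbove k), fun k => hF _,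
          biproduct.desc (fun k => biproduct.ι F (i.succAbove k)) ≫ f',
          X.prop_of_retract s hf'.1, fun A' hA' k => ?_⟩
        obtain ⟨k', hk'⟩ := hf'.2 hA' k
        exact ⟨k' ≫ r, by rw [Category.assoc, hr, hk']⟩
    rw [isUnit_iff_isIso] at ht ⊢
    have ht' : IsIso (𝟙 (F i) - (biproduct.ι F i ≫ g) ≫ biproduct.π F i) := by
      rwa [Category.assoc]
    have := isIso_id_sub_comp (biproduct.π F i) (biproduct.ι F i ≫ g) ht'
    rwa [← Category.assoc] at this
  have hu' : 1 - End.of u ∈ L := by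
    change (𝟙 (⨁ F) - u) ≫ f' = 0
    rw [Preadditive.sub_comp, Category.id_comp, hu, sub_self]
  have hunit := isUnit_one_sub_mul_sum L hL e Finset.univ (fun g hg i _ => hone g hg i) _ hu'
  have htot : ∑ i, e i = 1 := biproduct.total
  rw [htot, mul_one, sub_sub_cancel, isUnit_iff_isIso] at hunit
  exact hunit

/-- Wakamatsu's lemma. A morphism `A' ⟶ K[1]` with `A'` in `X` gives an extension `E` of `A'` by
`A`; the map `f` extends to `E`, and minimality makes this extension split. -/
lemma IsPrecover.rightOrthogonal_shift (hX : ClosedUnderExtensions X) {K A Z : C} {i : K ⟶ A}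
    {f : A ⟶ Z} {d : Z ⟶ K⟦(1 : ℤ)⟧} (hT : Triangle.mk i f d ∈ distTriang C)
    (hf : IsPrecover X f) (hmin : IsRightMinimal f) : X.rightOrthogonal (K⟦(1 : ℤ)⟧) := by
  intro A' g hA'
  obtain ⟨E, α, β, hE⟩ := distinguished_cocone_triangle₂ (g ≫ i⟦(1 : ℤ)⟧')
  obtain ⟨f', hαf', -⟩ : ∃ f' : E ⟶ Z, α ≫ f' = 𝟙 A ≫ f ∧ β ≫ (-g) = f' ≫ d :=
    complete_distinguished_triangle_morphism₂ _ _ hE (rot_of_distTriang _ hT) (𝟙 A) (-g) (by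
      change (g ≫ i⟦(1 : ℤ)⟧') ≫ (𝟙 A)⟦(1 : ℤ)⟧' = (-g) ≫ (-i⟦(1 : ℤ)⟧')
      simp)
  obtain ⟨h, hh⟩ := hf.2 (hX E ⟨_, _, _, _, _, hE, hf.1, hA'⟩) f'
  have : IsIso (α ≫ h) := hmin _ (by rw [Category.assoc, hh, hαf', Category.id_comp])
  have hz : g ≫ i⟦(1 : ℤ)⟧' = 0 := Triangle.mor₃_eq_zero_of_mono₁ _ hE (mono_of_mono α h)
  obtain ⟨g', hg'⟩ : ∃ g' : A' ⟶ Z, g = g' ≫ d := Triangle.coyoneda_exact₁ _ hT g hz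
  obtain ⟨g'', rfl⟩ := hf.2 hA' g'
  have hfd : f ≫ d = 0 := comp_distTriang_mor_zero₂₃ _ hT
  rw [hg', Category.assoc, hfd, comp_zero]

end Krull

/-! ### Precovering classes and co-`t`-structures -/

section Precovering

variable {X Y : ObjectProperty C}

lemma le_addClosure (P : ObjectProperty C) : P ≤ addClosure P :=
  fun Z hZ _ _ _ hPQ => hPQ Z hZ

instance isStableUnderRetracts_addClosure (P : ObjectProperty C) :
    (addClosure P).IsStableUnderRetracts where
  of_retract r h Q hQ hQ' hPQ := Q.prop_of_retract r (h Q hQ hQ' hPQ)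

lemma IsCosuspended.wedge_le_extensionProduct_of_isPrecoveringIn [X.IsStableUnderRetracts]
    (hC : IsKrullSchmidt C) (hX : IsCosuspended X) (hp : IsPrecoveringIn X (wedge X)) :
    wedge X ≤ (X.shift (1 : ℤ)).extensionProduct (injectiveObjects X) := by
  have := hX.isTriangulated_wedge
  have := hX.isStableUnderRetracts_injectiveObjects
  have key : wedge X ≤ X.extensionProduct ((injectiveObjects X).shift (-1)) := by
    intro Z hZ
    obtain ⟨A, f, hf⟩ := hp hZ
    obtain ⟨B, f', hf', hmin⟩ := hf.exists_isRightMinimal hC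
    obtain ⟨K, i, d, hT⟩ := distinguished_cocone_triangle₁ f'
    have hK : injectiveObjects X K := ⟨hf'.rightOrthogonal_shift hX.ext_closed hT hmin,
      (wedge X).ext_of_isTriangulatedClosed₁ _ hT (le_wedge _ hf'.1) hZ⟩
    exact ⟨_, _, _, _, _, rot_of_distTriang _ hT, hf'.1,
      (injectiveObjects X).prop_of_iso (shiftShiftNeg K (1 : ℤ)).symm hK⟩
  calc wedge X ≤ (wedge X).shift 1 := (wedge X).le_shift 1
    _ ≤ (X.extensionProduct ((injectiveObjects X).shift (-1))).shift 1 := shift_mono 1 key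
    _ ≤ (X.shift 1).extensionProduct (((injectiveObjects X).shift (-1)).shift 1) :=
        shift_extensionProduct_le 1
    _ = (X.shift (1 : ℤ)).extensionProduct (injectiveObjects X) := by rw [shift_shift_neg]

lemma IsCoTStructureOn.isPrecoveringIn (h : IsCoTStructureOn (thickClosure X) X Y) :
    IsPrecoveringIn X (wedge X) := by
  have := h.left_summands
  have := h.right_summands
  intro Z hZ
  rw [← h.left_cosuspended.thickClosure_eq] at hZ
  have hZ' := (thickClosure X).le_shift (-1) Z hZ
  rw [h.decomposition] at hZ'
  have hZ'' := shift_extensionProduct_le (-1) Z hZ'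
  rw [shift_neg_shift] at hZ''
  obtain ⟨A, B, f, g, k, hT, hA, hB⟩ := hZ''
  have hB' : X.rightOrthogonal B :=
    X.rightOrthogonal.prop_of_iso (shiftNegShift B (1 : ℤ)) (h.le_orthogonal _ hB)
  refine ⟨A, f, hA, fun A' hA' a => ?_⟩
  obtain ⟨a', ha'⟩ := Triangle.coyoneda_exact₂ _ hT a (hB' _ hA')
  exact ⟨a', ha'.symm⟩

lemma IsCoTStructureOn.left_eq_addClosure {U : ObjectProperty C}
    (h : IsCoTStructureOn U X Y) : X = addClosure X :=
  le_antisymm (le_addClosure X) fun _ hZ =>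
    hZ X h.left_subcategory h.left_summands le_rfl

end Precovering

end TriangAB

theorem theorem3p7 (C : Type u) [Category.{v} C] [HasZeroObject C] [HasShift C ℤ]
    [Preadditive C] [∀ n : ℤ, (shiftFunctor C n).Additive] [Pretriangulated C]
    [IsTriangulated C] :
    (TriangAB.relABContexts C = TriangAB.coTStructures C ∧
      Set.BijOn (fun p : ObjectProperty C × ObjectProperty C => (p.1, TriangAB.wedge p.2))
        (TriangAB.cogeneratorPairs C) (TriangAB.relABContexts C) ∧
      Set.MapsTo (fun p : ObjectProperty C × ObjectProperty C => (p.1, p.1 ⊓ p.2))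
        (TriangAB.relABContexts C) (TriangAB.cogeneratorPairs C) ∧
      Set.InvOn (fun p : ObjectProperty C × ObjectProperty C => (p.1, p.1 ⊓ p.2))
        (fun p : ObjectProperty C × ObjectProperty C => (p.1, TriangAB.wedge p.2))
        (TriangAB.cogeneratorPairs C) (TriangAB.relABContexts C)) ∧
    (∀ (R : Type w) [CommRing R] [IsArtinianRing R] [Linear R C],
      TriangAB.IsHomFinite C R → TriangAB.IsKrullSchmidt C →
      Set.BijOn (fun X : ObjectProperty C =>
          (X, X.rightOrthogonal.shift (1 : ℤ) ⊓ TriangAB.wedge X))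
        (TriangAB.precoveringClasses C) (TriangAB.coTStructures C) ∧
      Set.MapsTo (fun p : ObjectProperty C × ObjectProperty C => p.1)
        (TriangAB.coTStructures C) (TriangAB.precoveringClasses C) ∧
      Set.InvOn (fun p : ObjectProperty C × ObjectProperty C => p.1)
        (fun X : ObjectProperty C =>
          (X, X.rightOrthogonal.shift (1 : ℤ) ⊓ TriangAB.wedge X))
        (TriangAB.precoveringClasses C) (TriangAB.coTStructures C)) := by
  refine ⟨?_, fun R _ _ _ _ hC => ?_⟩
  · have hmaps : Set.MapsTo
        (fun p : ObjectProperty C × ObjectProperty C => (p.1, TriangAB.wedge p.2))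
        (TriangAB.cogeneratorPairs C) (TriangAB.relABContexts C) := by
      rintro ⟨X, ω⟩ ⟨hX', hω', hX, hω, hc⟩
      dsimp only at hX' hω' hX hω hc
      have h := hX.inf_injectiveObjects_eq hω hc
      change TriangAB.IsRelABContext X (TriangAB.wedge ω)
      rw [hX.wedge_eq_injectiveObjects hω hc]
      exact ⟨hX, hX', hX.isSuspended_injectiveObjects,
        hX.isStableUnderRetracts_injectiveObjects, inf_le_right, by rwa [h], by rwa [h]⟩
    have hmaps' : Set.MapsTo (fun p : ObjectProperty C × ObjectProperty C => (p.1, p.1 ⊓ p.2))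
        (TriangAB.relABContexts C) (TriangAB.cogeneratorPairs C) := by
      rintro ⟨X, Y⟩ h
      have hX := h.left_summands
      have hY := h.right_summands
      exact ⟨hX, TriangAB.isStableUnderRetracts_inf, h.left_cosuspended, h.injective,
        h.cogenerator⟩
    have hinv : Set.InvOn (fun p : ObjectProperty C × ObjectProperty C => (p.1, p.1 ⊓ p.2))
        (fun p : ObjectProperty C × ObjectProperty C => (p.1, TriangAB.wedge p.2))
        (TriangAB.cogeneratorPairs C) (TriangAB.relABContexts C) := by
      constructor
      · rintro ⟨X, ω⟩ ⟨hX', hω', hX, hω, hc⟩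
        dsimp only at hX' hω' hX hω hc
        refine Prod.ext rfl ?_
        dsimp only
        rw [hX.wedge_eq_injectiveObjects hω hc, hX.inf_injectiveObjects_eq hω hc]
      · rintro ⟨X, Y⟩ h
        have := h.left_summands
        have := h.right_summands
        exact Prod.ext rfl (h.left_cosuspended.eq_wedge h.right_suspended h.right_le
          h.cogenerator).symm
    exact ⟨Set.ext fun p => ⟨fun h => h.isCoTStructureOn, fun h => h.isRelABContext⟩,
      hinv.bijOn hmaps hmaps', hmaps', hinv⟩
  · have hmaps : Set.MapsTo
        (fun X : ObjectProperty C => (X, X.rightOrthogonal.shift (1 : ℤ) ⊓ TriangAB.wedge X))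
        (TriangAB.precoveringClasses C) (TriangAB.coTStructures C) := by
      rintro X ⟨hX, hp, hadd⟩
      have : X.IsStableUnderRetracts := hadd ▸ TriangAB.isStableUnderRetracts_addClosure X
      exact hX.isCoTStructureOn (hX.wedge_le_extensionProduct_of_isPrecoveringIn hC hp)
    have hmaps' : Set.MapsTo (fun p : ObjectProperty C × ObjectProperty C => p.1)
        (TriangAB.coTStructures C) (TriangAB.precoveringClasses C) := by
      rintro ⟨X, Y⟩ h
      have := h.left_summands
      exact ⟨h.left_cosuspended, h.isPrecoveringIn, h.left_eq_addClosure⟩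
    have hinv : Set.InvOn (fun p : ObjectProperty C × ObjectProperty C => p.1)
        (fun X : ObjectProperty C => (X, X.rightOrthogonal.shift (1 : ℤ) ⊓ TriangAB.wedge X))
        (TriangAB.precoveringClasses C) (TriangAB.coTStructures C) :=
      ⟨fun X _ => rfl, fun p h => Prod.ext rfl h.eq_injectiveObjects.symm⟩
    exact ⟨hinv.bijOn hmaps hmaps', hmaps', hinv⟩
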